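/- Let $m,n\ge 3$ be integers. For a real $2\times m$ matrix $M$ let $P(M)\subset\mathbb R^2$ be the convex hull of the columns of $M$, and let $R_{2,m}\subset\mathbb R^{2\times m}$ be the set of those $M$ whose columns are in convex position and affinely span $\mathbb R^2$ (so that $P(M)$ is a convex $m$-gon). For a real $n\times 2$ matrix $M'$ let $Q(M')=\{x\in\mathbb R^2 : M'x\le \mathbf 1\}$, where $\mathbf 1$ is the all-ones vector, and let $R'_{2,n}\subset\mathbb R^{n\times 2}$ be the set of those $M'$ for which $Q(M')$ is a (bounded) convex polygon with exactly $n$ edges. For $M\in R_{2,m}$ and $M'\in R'_{2,n}$ let $\mathrm{Hom}(P(M),Q(M'))$ be the polytope of affine maps $P(M)\to Q(M')$, regarded as a subset of the 6-dimensional vector space of affine maps $\mathbb R^2\to\mathbb R^2$ (an affine map on $P(M)$ extends uniquely to $\mathbb R^2$). Theorem. There is a dense open subset $U_{m,n}$ of $R_{2,m}\times R'_{2,n}$ such that for every $(M,M')\in U_{m,n}$ the polytope $\mathrm{Hom}(P(M),Q(M'))$ has dimension $6$, and every vertex $f$ of $\mathrm{Hom}(P(M),Q(M'))$ of rank two (that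 is, with $\dim f(P(M))=2$) is a simple vertex, i.e. it lies in exactly $\dim \mathrm{Hom}(P(M),Q(M'))=6$ facets of $\mathrm{Hom}(P(M),Q(M'))$. -/

import Mathlib

open scoped Matrix

noncomputable section

namespace HomPolytope

/-- The dimension of a nonempty subset of a real vector space: the dimension of its affine hull. -/
def affDim {E : Type*} [AddCommGroup E] [Module ℝ E] (S : Set E) : ℕ :=
  Module.finrank ℝ (vectorSpan ℝ S)

/-- `F` is a facet of `K`: a nonempty face, i.e. the set of points of `K` at which some linear
functional attains its maximum over `K`, of dimension `dim K - 1`. -/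
def IsFacet {E : Type*} [AddCommGroup E] [Module ℝ E] (K F : Set E) : Prop :=
  F.Nonempty ∧ (∃ l : E →ₗ[ℝ] ℝ, F = {x ∈ K | ∀ y ∈ K, l y ≤ l x}) ∧ affDim F + 1 = affDim K

/-- `x` is a simple vertex of `K`: a vertex contained in exactly `dim K` facets of `K`. -/
def IsSimpleVertex {E : Type*} [AddCommGroup E] [Module ℝ E] (K : Set E) (x : E) : Prop :=
  x ∈ Set.extremePoints ℝ K ∧ {F : Set E | IsFacet K F ∧ x ∈ F}.encard = affDim K

/-- The polytope `P(M)`: the convex hull of the columns of `M`. -/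
def polyP {d m : ℕ} (M : Matrix (Fin d) (Fin m) ℝ) : Set (Fin d → ℝ) :=
  convexHull ℝ (Set.range M.col)

/-- The polyhedron `Q(M')`: the solutions of the system of inequalities `M' x ≤ 1`. -/
def polyQ {n e : ℕ} (M' : Matrix (Fin n) (Fin e) ℝ) : Set (Fin e → ℝ) :=
  {x | M' *ᵥ x ≤ 1}

/-- The space `R_{d,m}` of matrices whose columns are in convex position and affinely span `ℝ^d`,
i.e. for which `P(M)` is a `d`-polytope with `m` vertices. -/
def realizationR (d m : ℕ) : Set (Matrix (Fin d) (Fin m) ℝ) :=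
  {M | ConvexIndependent ℝ M.col ∧ affineSpan ℝ (Set.range M.col) = ⊤}

/-- The space `R'_{e,n}` of matrices for which `Q(M')` is an `e`-polytope (a bounded polyhedron of
dimension `e`) with exactly `n` facets. -/
def realizationR' (e n : ℕ) : Set (Matrix (Fin n) (Fin e) ℝ) :=
  {M' | Bornology.IsBounded (polyQ M') ∧ affDim (polyQ M') = e ∧
    {F | IsFacet (polyQ M') F}.encard = n}

/-- The hom-polytope `Hom(P, Q)` of a set `P` that affinely spans `E` and a set `Q` in `E'`: affine
maps `P → Q` are identified with the affine maps `E → E'` carrying `P` into `Q`. -/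
def homSet {E E' : Type*} [AddCommGroup E] [Module ℝ E] [AddCommGroup E'] [Module ℝ E']
    (P : Set E) (Q : Set E') : Set (E →ᵃ[ℝ] E') :=
  {f | Set.MapsTo f P Q}

end HomPolytope

end

/-! `Hom(P(M), Q(M'))` is cut out of the 6-dimensional space of affine maps by the `m * n`
inequalities "row `j` of `M'` at `f` (column `i` of `M`) is at most 1". The zero map satisfies all
of them strictly, so the dimension is 6. At a vertex the tight functionals separate points of the
whole space; if at most 6 are tight, they form a basis of the dual, and each of them defines its own
facet (`isSimpleVertex_of_card_tight_le`). It remains to show that generically a map of rank two has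
at most 6 tight constraints.

This is a parameter count. Let `f` be bijective, `g` its inverse, `q i` the image of column `i`.
Generically no three of the lines `row j = 1` are concurrent, so `q i` lies on at most two of them,
and each incidence removes one free coordinate of `q i`. With `t` incidences, `(M, M')` is a
rational function of `g` (6 parameters), `M'` (`2 * n`) and the remaining coordinates of the `q i`
(`2 * m - t`). If `t > 6`, these are fewer than the `2 * m + 2 * n` entries, so the entries satisfy
a nonzero polynomial relation (`exists_relation_of_card_lt`) that depends only on the incidence
pattern. There are finitely many patterns, so one nonzero polynomial excludes them all. Its
nonvanishing locus is open, and it is dense because both realization spaces are open in the spaces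
of matrices. -/

namespace HomPolytope

/-! ### Facets and simple vertices of polyhedra with the origin strictly inside -/

section Polyhedron

variable {ι E : Type*} [AddCommGroup E] [Module ℝ E]

/-- The polyhedron of all points at which each functional of a family is at most one. -/
def polyhedron (l : ι → E →ₗ[ℝ] ℝ) : Set E := {x | ∀ s, l s x ≤ 1}

/-- The face of a polyhedron at which a given constraint is tight. -/
def tightFace (l : ι → E →ₗ[ℝ] ℝ) (s : ι) : Set E := {x ∈ polyhedron l | l s x = 1}

theorem exists_pos_mul_lt [Finite ι] (a b : ι → ℝ) :
    ∃ ε > (0 : ℝ), ∀ s, 0 < a s → ε * |b s| < a s := by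
  have h : ∀ᶠ ε in nhdsWithin (0 : ℝ) (Set.Ioi 0), ∀ s, 0 < a s → ε * |b s| < a s := by
    rw [Filter.eventually_all]
    intro s
    by_cases hs : 0 < a s
    · have hc : Filter.Tendsto (fun ε : ℝ => ε * |b s|) (nhdsWithin 0 (Set.Ioi 0)) (nhds 0) := by
        have : Continuous fun ε : ℝ => ε * |b s| := by fun_prop
        simpa using (this.tendsto 0).mono_left nhdsWithin_le_nhds
      filter_upwards [hc.eventually_lt_const hs] with ε hε _ using hε
    · exact Filter.Eventually.of_forall fun _ h => absurd h hs
  obtain ⟨ε, h1, h2⟩ := (h.and self_mem_nhdsWithin).exists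
  exact ⟨ε, h2, h1⟩

/-- From a point of a polyhedron one can move a little in every direction along which the tight
functionals do not increase, and no new constraint becomes tight. -/
theorem exists_add_smul_mem [Finite ι] (l : ι → E →ₗ[ℝ] ℝ) {x : E} (hx : x ∈ polyhedron l) (v : E)
    (hv : ∀ s, l s x = 1 → l s v ≤ 0) :
    ∃ ε > (0 : ℝ), x + ε • v ∈ polyhedron l ∧ ∀ s, l s (x + ε • v) = 1 → l s x = 1 ∧ l s v = 0 := by
  obtain ⟨ε, hε, h⟩ := exists_pos_mul_lt (fun s => 1 - l s x) (fun s => l s v)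
  have key : ∀ s, l s (x + ε • v) < 1 ∨ (l s (x + ε • v) = 1 ∧ l s x = 1 ∧ l s v = 0) := by
    intro s
    rw [map_add, map_smul, smul_eq_mul]
    rcases (hx s).lt_or_eq with h1 | h1
    · left
      have h2 := h s (by simpa using h1)
      have h3 := mul_le_mul_of_nonneg_left (le_abs_self (l s v)) hε.le
      linarith
    · rcases (hv s h1).lt_or_eq with h2 | h2
      · left
        nlinarith
      · right
        simp [h1, h2]
  refine ⟨ε, hε, fun s => ?_, fun s hs => ?_⟩
  · rcases key s with h | h
    · exact h.le
    · exact h.1.le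
  · rcases key s with h | h
    · exact absurd hs h.ne
    · exact h.2

theorem zero_mem_polyhedron (l : ι → E →ₗ[ℝ] ℝ) : (0 : E) ∈ polyhedron l := fun s => by simp

theorem vectorSpan_polyhedron [Finite ι] (l : ι → E →ₗ[ℝ] ℝ) :
    vectorSpan ℝ (polyhedron l) = ⊤ := by
  rw [eq_top_iff]
  rintro v -
  obtain ⟨ε, hε, h, -⟩ := exists_add_smul_mem l (zero_mem_polyhedron l) v (by simp)
  have := vsub_mem_vectorSpan ℝ h (zero_mem_polyhedron l)
  simp only [zero_add, vsub_eq_sub, sub_zero] at this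
  exact (Submodule.smul_mem_iff _ hε.ne').1 this

theorem affDim_polyhedron [Finite ι] (l : ι → E →ₗ[ℝ] ℝ) :
    affDim (polyhedron l) = Module.finrank ℝ E := by
  rw [affDim, vectorSpan_polyhedron, finrank_top]

theorem finrank_ker_add_one [FiniteDimensional ℝ E] (l : E →ₗ[ℝ] ℝ) (hl : l ≠ 0) :
    Module.finrank ℝ (LinearMap.ker l) + 1 = Module.finrank ℝ E :=
  Module.Dual.finrank_ker_add_one_of_ne_zero hl

/-- From a point where only `s` is tight one can move in every direction of `ker (l s)`, so the
tight face has codimension one. -/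
theorem isFacet_tightFace [Finite ι] [FiniteDimensional ℝ E] (l : ι → E →ₗ[ℝ] ℝ) {s : ι} {x : E}
    (hx : x ∈ polyhedron l) (hs : l s x = 1) (ht : ∀ t, l t x = 1 → t = s) :
    IsFacet (polyhedron l) (tightFace l s) := by
  refine ⟨⟨x, hx, hs⟩, ⟨l s, ?_⟩, ?_⟩
  · ext y
    refine ⟨fun hy => ⟨hy.1, fun z hz => ?_⟩, fun hy => ⟨hy.1, ?_⟩⟩
    · rw [hy.2]
      exact hz s
    · exact le_antisymm (hy.1 s) (hs ▸ hy.2 x hx)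
  · have hspan : vectorSpan ℝ (tightFace l s) = LinearMap.ker (l s) := by
      apply le_antisymm
      · rw [vectorSpan_def, Submodule.span_le]
        rintro _ ⟨y, hy, z, hz, rfl⟩
        simp [hy.2, hz.2]
      · intro v hv
        rw [LinearMap.mem_ker] at hv
        obtain ⟨ε, hε, h, -⟩ := exists_add_smul_mem l hx v
          (fun t h => by rw [ht t h, hv])
        have h2 : x + ε • v ∈ tightFace l s := ⟨h, by simp [hs, hv]⟩
        have := vsub_mem_vectorSpan ℝ h2 ⟨hx, hs⟩
        simp only [vsub_eq_sub, add_sub_cancel_left] at this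
        exact (Submodule.smul_mem_iff _ hε.ne').1 this
    rw [affDim_polyhedron, affDim, hspan]
    refine finrank_ker_add_one _ fun h => ?_
    simp [h] at hs

/-- Every facet of a polyhedron has a point at which some constraint is tight and at which the
only tight constraints are those that define the facet. -/
theorem IsFacet.exists_mem [Finite ι] [FiniteDimensional ℝ E] {l : ι → E →ₗ[ℝ] ℝ} {F : Set E}
    (hF : IsFacet (polyhedron l) F) :
    ∃ z ∈ F, (∃ s, l s z = 1) ∧ ∀ s, l s z = 1 → F = tightFace l s := by
  obtain ⟨hne, ⟨g, hg⟩, hdim⟩ := hF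
  rw [affDim_polyhedron] at hdim
  have hFK : F ⊆ polyhedron l := by rw [hg]; exact Set.sep_subset _ _
  have hgF : ∀ x ∈ F, ∀ y ∈ F, g x = g y := by
    intro x hx y hy
    rw [hg] at hx hy
    exact le_antisymm (hy.2 x hx.1) (hx.2 y hy.1)
  have hg0 : g ≠ 0 := by
    rintro rfl
    have : F = polyhedron l := by simp [hg]
    rw [this, affDim_polyhedron] at hdim
    omega
  -- A relatively interior point: take a minimal tight set. A constraint is tight at the midpoint of
  -- `z` and `y` only if it is tight at both, so minimality makes it the least tight set on `F`.
  obtain ⟨z, hz, hmin⟩ : ∃ z ∈ F, ∀ y ∈ F, {s | l s z = 1} ⊆ {s | l s y = 1} := by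
    obtain ⟨T, ⟨z, hz, rfl⟩, hT⟩ := (Set.toFinite ((fun z => {s | l s z = 1}) '' F)).exists_minimal
      (hne.image _)
    refine ⟨z, hz, fun y hy s hs => ?_⟩
    have hw : (2⁻¹ : ℝ) • (z + y) ∈ F := by
      have h1 := hFK hz
      have h2 := hFK hy
      have h3 := hgF z hz y hy
      rw [hg] at hz ⊢
      refine ⟨fun s => ?_, fun u hu => ?_⟩
      · have := h1 s
        have := h2 s
        simp only [map_smul, map_add, smul_eq_mul]
        linarith
      · have := hz.2 u hu
        simp only [map_smul, map_add, smul_eq_mul]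
        linarith
    have hwT := hT ⟨_, hw, rfl⟩ (fun t ht => by
      have h1 := hFK hz t
      have h2 := hFK hy t
      simp only [Set.mem_ofPred_eq, map_smul, map_add, smul_eq_mul] at ht ⊢
      linarith) hs
    have h1 := hFK hz s
    have h2 := hFK hy s
    simp only [Set.mem_ofPred_eq, map_smul, map_add, smul_eq_mul] at hwT hs ⊢
    linarith
  refine ⟨z, hz, ?_, fun s hs => ?_⟩
  -- With nothing tight, every direction is feasible at the maximum point `z` of `g`, which forces
  -- `g = 0`.
  · by_contra! h
    refine hg0 (LinearMap.ext fun v => ?_)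
    have hle : ∀ v, g v ≤ 0 := by
      intro v
      obtain ⟨ε, hε, h', -⟩ := exists_add_smul_mem l (hFK hz) v (fun s hs => absurd hs (h s))
      rw [hg] at hz
      have := hz.2 _ h'
      simp only [map_add, map_smul, smul_eq_mul] at this
      nlinarith
    have := hle (-v)
    rw [map_neg] at this
    rw [LinearMap.zero_apply]
    exact le_antisymm (hle v) (by linarith)
  -- The direction space of `F` lies in both kernels and has their dimension, so `g` and `l s` have
  -- the same kernel.
  · have hs0 : l s ≠ 0 := fun h => by simp [h] at hs
    have e1 : vectorSpan ℝ F = LinearMap.ker g := by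
      refine Submodule.eq_of_le_of_finrank_eq ?_ ?_
      · rw [vectorSpan_def, Submodule.span_le]
        rintro _ ⟨x, hx, y, hy, rfl⟩
        simp [hgF x hx y hy]
      · have := finrank_ker_add_one g hg0
        rw [affDim] at hdim
        omega
    have e2 : vectorSpan ℝ F = LinearMap.ker (l s) := by
      refine Submodule.eq_of_le_of_finrank_eq ?_ ?_
      · rw [vectorSpan_def, Submodule.span_le]
        rintro _ ⟨x, hx, y, hy, rfl⟩
        have h1 : l s x = 1 := hmin x hx hs
        have h2 : l s y = 1 := hmin y hy hs
        simp [h1, h2]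
      · have := finrank_ker_add_one (l s) hs0
        rw [affDim] at hdim
        omega
    refine Set.Subset.antisymm (fun y hy => ⟨hFK hy, hmin y hy hs⟩) fun y hy => ?_
    have hk : y - z ∈ LinearMap.ker g := by
      rw [← e1, e2]
      simp [hy.2, hs]
    rw [LinearMap.mem_ker, map_sub, sub_eq_zero] at hk
    rw [hg] at hz ⊢
    exact ⟨hy.1, fun u hu => hk ▸ hz.2 u hu⟩

/-- A polyhedron has as many facets as constraints if and only if every constraint is
irredundant. -/
theorem encard_facets_eq_iff [Fintype ι] [FiniteDimensional ℝ E] (l : ι → E →ₗ[ℝ] ℝ) :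
    {F | IsFacet (polyhedron l) F}.encard = Fintype.card ι ↔
      ∀ s, ∃ x ∈ polyhedron l, l s x = 1 ∧ ∀ t, l t x = 1 → t = s := by
  have hsub : {F | IsFacet (polyhedron l) F} ⊆ Set.range (tightFace l) := by
    intro F hF
    obtain ⟨z, -, ⟨s, hs⟩, h⟩ := IsFacet.exists_mem hF
    exact ⟨s, (h s hs).symm⟩
  have hle : (Set.range (tightFace l)).encard ≤ Fintype.card ι := by
    rw [← Set.image_univ]
    refine (Set.encard_image_le _ _).trans ?_
    simp
  constructor
  -- There are at most as many tight faces as constraints, so equality forces all of them to be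
  -- facets and to be distinct.
  · intro h s
    have heq : {F | IsFacet (polyhedron l) F} = Set.range (tightFace l) :=
      ((Set.finite_range _).subset hsub).eq_of_subset_of_encard_le hsub (hle.trans h.ge)
    have hinj : Function.Injective (tightFace l) := by
      rw [← Set.injOn_univ]
      refine Set.finite_univ.injOn_of_encard_image_eq ?_
      rw [Set.image_univ, ← heq, h]
      simp
    have hs : IsFacet (polyhedron l) (tightFace l s) := by
      have : tightFace l s ∈ Set.range (tightFace l) := ⟨s, rfl⟩
      rwa [← heq] at this
    obtain ⟨z, hz, -, h⟩ := IsFacet.exists_mem hs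
    exact ⟨z, hz.1, hz.2, fun t ht => (hinj (h t ht)).symm⟩
  · intro h
    have heq : {F | IsFacet (polyhedron l) F} = Set.range (tightFace l) := by
      refine hsub.antisymm ?_
      rintro _ ⟨s, rfl⟩
      obtain ⟨x, hx, hs, ht⟩ := h s
      exact isFacet_tightFace l hx hs ht
    have hinj : Function.Injective (tightFace l) := by
      intro s t hst
      obtain ⟨x, hx, hs, ht⟩ := h s
      have : x ∈ tightFace l t := hst ▸ ⟨hx, hs⟩
      exact (ht t this.2).symm
    rw [heq, ← Set.image_univ, hinj.encard_image]
    simp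

/-- An extreme point of a polyhedron at which at most as many constraints as the dimension are
tight is a simple vertex. -/
theorem isSimpleVertex_of_card_tight_le [Fintype ι] [FiniteDimensional ℝ E]
    (l : ι → E →ₗ[ℝ] ℝ) {x : E} (hx : x ∈ (polyhedron l).extremePoints ℝ)
    (hcard : Nat.card {s // l s x = 1} ≤ Module.finrank ℝ E) :
    IsSimpleVertex (polyhedron l) x := by
  classical
  refine ⟨hx, ?_⟩
  -- A vector killed by all tight functionals would give a segment through `x` inside the
  -- polyhedron; hence `φ` is injective at an extreme point, and bijective by the cardinality bound.
  let φ : E →ₗ[ℝ] ({s // l s x = 1} → ℝ) := LinearMap.pi fun s => l s.1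
  have hφ : Function.Injective φ := by
    rw [← LinearMap.ker_eq_bot, LinearMap.ker_eq_bot']
    intro v hv
    have hv' : ∀ s, l s x = 1 → l s v = 0 := fun s hs => congrFun hv ⟨s, hs⟩
    obtain ⟨ε, hε, h1, -⟩ := exists_add_smul_mem l hx.1 v (fun s hs => (hv' s hs).le)
    obtain ⟨δ, hδ, h2, -⟩ := exists_add_smul_mem l hx.1 (-v)
      (fun s hs => by simp [hv' s hs])
    have hmem : x ∈ openSegment ℝ (x + ε • v) (x + δ • -v) := by
      refine ⟨δ / (ε + δ), ε / (ε + δ), by positivity, by positivity, by field_simp; ring, ?_⟩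
      match_scalars <;> field_simp <;> ring
    have := hx.2 h1 h2 hmem
    simpa [hε.ne'] using this
  have hd : Module.finrank ℝ ({s // l s x = 1} → ℝ) = Nat.card {s // l s x = 1} := by
    rw [Module.finrank_fintype_fun_eq_card, Nat.card_eq_fintype_card]
  have heq : Module.finrank ℝ E = Module.finrank ℝ ({s // l s x = 1} → ℝ) :=
    le_antisymm (LinearMap.finrank_le_finrank_of_injective hφ) (hd ▸ hcard)
  have hsurj : Function.Surjective φ :=
    (LinearMap.injective_iff_surjective_of_finrank_eq_finrank heq).1 hφ
  have hirr : ∀ s, l s x = 1 → ∃ y ∈ polyhedron l, l s y = 1 ∧ ∀ t, l t y = 1 → t = s := by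
    intro s hs
    -- Along `v` the constraint `s` stays tight while every other tight constraint becomes strict.
    obtain ⟨v, hv⟩ := hsurj fun t => if t.1 = s then 0 else -1
    have hv' : ∀ t, l t x = 1 → l t v = if t = s then 0 else -1 := fun t ht => congrFun hv ⟨t, ht⟩
    obtain ⟨ε, hε, h1, h2⟩ := exists_add_smul_mem l hx.1 v (fun t ht => by
      rw [hv' t ht]; split_ifs <;> norm_num)
    refine ⟨_, h1, ?_, fun t ht => ?_⟩
    · simp [hs, hv' s hs]
    · obtain ⟨h3, h4⟩ := h2 t ht
      rw [hv' t h3] at h4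
      by_contra hne
      simp [hne] at h4
  have hset : {F : Set E | IsFacet (polyhedron l) F ∧ x ∈ F} = tightFace l '' {s | l s x = 1} := by
    ext F
    constructor
    · rintro ⟨hF, hxF⟩
      obtain ⟨z, hz, ⟨s, hs⟩, h⟩ := IsFacet.exists_mem hF
      have hFs := h s hs
      rw [hFs] at hxF
      exact ⟨s, hxF.2, hFs.symm⟩
    · rintro ⟨s, hs, rfl⟩
      obtain ⟨y, hy, h1, h2⟩ := hirr s hs
      exact ⟨isFacet_tightFace l hy h1 h2, hx.1, hs⟩
  have hinj : Set.InjOn (tightFace l) {s | l s x = 1} := by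
    intro s hs t ht hst
    obtain ⟨y, hy, h1, h2⟩ := hirr s hs
    have : y ∈ tightFace l t := hst ▸ ⟨hy, h1⟩
    exact (h2 t this.2).symm
  rw [hset, hinj.encard_image, affDim_polyhedron, heq, hd]
  rw [← (Set.toFinite _).cast_ncard_eq]
  rfl

end Polyhedron

/-! ### Algebraic dependence of rational functions -/

section RationalFamilies

variable {σ V : Type*}

/-- More rational functions than variables satisfy a polynomial relation, which can be evaluated
wherever the denominators do not vanish. -/
theorem exists_relation_of_card_lt [Fintype σ] [Fintype V] (h : Fintype.card σ < Fintype.card V)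
    (N D : V → MvPolynomial σ ℝ) :
    ∃ H : MvPolynomial V ℝ, H ≠ 0 ∧ ∀ c : σ → ℝ, (∀ v, MvPolynomial.eval c (D v) ≠ 0) →
      MvPolynomial.eval (fun v => MvPolynomial.eval c (N v) / MvPolynomial.eval c (D v)) H = 0 := by
  classical
  by_cases hD : ∀ v, D v ≠ 0
  swap
  · push Not at hD
    obtain ⟨v, hv⟩ := hD
    -- If some denominator is the zero polynomial, no `c` is admissible and any nonzero `H` works.
    exact ⟨1, one_ne_zero, fun c hc => absurd (by simp [hv]) (hc v)⟩
  let P : MvPolynomial σ ℝ := ∏ v, D v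
  have hP : P ≠ 0 := Finset.prod_ne_zero_iff.2 fun v _ => hD v
  have hle : Submonoid.powers P ≤ nonZeroDivisors _ := powers_le_nonZeroDivisors_of_noZeroDivisors hP
  -- All the fractions live in `B`, which is algebraic over the polynomial ring and so has
  -- transcendence degree `Fintype.card σ`.
  let B := Localization.Away P
  have hdom : IsDomain B := IsLocalization.isDomain_of_le_nonZeroDivisors _ hle
  have hinj : Function.Injective (algebraMap (MvPolynomial σ ℝ) B) :=
    IsLocalization.injective B hle
  have : FaithfulSMul (MvPolynomial σ ℝ) B := (faithfulSMul_iff_algebraMap_injective _ _).2 hinj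
  have : Algebra.IsAlgebraic (MvPolynomial σ ℝ) B := IsLocalization.isAlgebraic _ (Submonoid.powers P)
  have hB := ((IsTranscendenceBasis.mvPolynomial σ ℝ).algebraMap_comp (A := B)).lift_cardinalMk_eq_trdeg
  have hunit : ∀ v, IsUnit (algebraMap (MvPolynomial σ ℝ) B (D v)) := fun v =>
    isUnit_of_dvd_unit ((algebraMap _ B).map_dvd (Finset.dvd_prod_of_mem D (Finset.mem_univ v)))
      (IsLocalization.Away.algebraMap_isUnit P)
  let y : V → B := fun v => algebraMap _ B (N v) * ↑(hunit v).unit⁻¹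
  have hy : ¬ AlgebraicIndependent ℝ y := by
    intro hy
    have h1 := hy.lift_cardinalMk_le_trdeg
    rw [← Cardinal.lift_id (Algebra.trdeg ℝ B), ← hB] at h1
    simp only [Cardinal.mk_fintype, Cardinal.lift_natCast, Nat.cast_le] at h1
    omega
  rw [algebraicIndependent_iff] at hy
  push Not at hy
  obtain ⟨H, hH, hH0⟩ := hy
  refine ⟨H, hH0, fun c hc => ?_⟩
  let f : MvPolynomial σ ℝ →ₐ[ℝ] ℝ := MvPolynomial.aeval c
  have hf : ∀ a, f a = MvPolynomial.eval c a := fun a => by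
    rw [← MvPolynomial.coe_aeval_eq_eval]
    rfl
  have hcP : f P ≠ 0 := by
    rw [hf, map_prod]
    exact Finset.prod_ne_zero_iff.2 fun v _ => hc v
  -- Evaluation at `c` extends to `B` because `P` does not vanish at `c`; it carries the relation in
  -- `B` to real numbers.
  let e : B →ₐ[ℝ] ℝ := IsLocalization.liftAlgHom (M := Submonoid.powers P) (f := f) (by
    rintro ⟨_, k, rfl⟩
    exact (isUnit_iff_ne_zero.2 (by simpa using pow_ne_zero k hcP)))
  have he : ∀ a, e (algebraMap _ B a) = MvPolynomial.eval c a := fun a => by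
    rw [← hf]
    exact IsLocalization.lift_eq _ a
  have hye : ∀ v, e (y v) = MvPolynomial.eval c (N v) / MvPolynomial.eval c (D v) := fun v => by
    rw [eq_div_iff (hc v), ← he, ← he, ← map_mul]
    simp only [y, mul_assoc, IsUnit.val_inv_mul, mul_one]
  have := congrArg e hH
  rw [map_zero, MvPolynomial.comp_aeval_apply] at this
  simp only [hye] at this
  rwa [← MvPolynomial.coe_aeval_eq_eval]

/-- A nonzero polynomial does not vanish identically on a nonempty open set. -/
theorem exists_mem_eval_ne_zero [Fintype V] {H : MvPolynomial V ℝ} (hH : H ≠ 0)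
    {O : Set (V → ℝ)} (hO : IsOpen O) (hne : O.Nonempty) : ∃ x ∈ O, MvPolynomial.eval x H ≠ 0 := by
  by_contra! h
  obtain ⟨x, hx⟩ := hne
  obtain ⟨u, hu, hsub⟩ := isOpen_pi_iff'.1 hO x hx
  refine hH (MvPolynomial.funext_set u (fun i => ?_) fun x hx => ?_)
  · exact infinite_of_mem_nhds (x i) ((hu i).1.mem_nhds (hu i).2)
  · rw [h x (hsub hx), map_zero]

end RationalFamilies

/-! ### Properties valid off the zero set of a nonzero polynomial -/

section Generic

variable {V : Type*}

/-- A property of real vectors that holds wherever some nonzero polynomial does not vanish. -/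
def IsGeneric (p : (V → ℝ) → Prop) : Prop :=
  ∃ H : MvPolynomial V ℝ, H ≠ 0 ∧ ∀ x, MvPolynomial.eval x H ≠ 0 → p x

theorem IsGeneric.mono {p q : (V → ℝ) → Prop} (hp : IsGeneric p) (h : ∀ x, p x → q x) :
    IsGeneric q := by
  obtain ⟨H, h0, h1⟩ := hp
  exact ⟨H, h0, fun x hx => h x (h1 x hx)⟩

theorem IsGeneric.and {p q : (V → ℝ) → Prop} (hp : IsGeneric p) (hq : IsGeneric q) :
    IsGeneric fun x => p x ∧ q x := by
  obtain ⟨H, h0, h1⟩ := hp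
  obtain ⟨K, k0, k1⟩ := hq
  refine ⟨H * K, mul_ne_zero h0 k0, fun x hx => ?_⟩
  rw [map_mul] at hx
  exact ⟨h1 x (left_ne_zero_of_mul hx), k1 x (right_ne_zero_of_mul hx)⟩

theorem IsGeneric.of_forall {p : (V → ℝ) → Prop} (h : ∀ x, p x) : IsGeneric p :=
  ⟨1, one_ne_zero, fun x _ => h x⟩

theorem isGeneric_all {κ : Type*} [Finite κ] {p : κ → (V → ℝ) → Prop}
    (h : ∀ i, IsGeneric (p i)) : IsGeneric fun x => ∀ i, p i x := by
  cases nonempty_fintype κ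
  choose H h0 h1 using h
  refine ⟨∏ i, H i, Finset.prod_ne_zero_iff.2 fun i _ => h0 i, fun x hx i => h1 i x ?_⟩
  rw [map_prod] at hx
  exact Finset.prod_ne_zero_iff.1 hx i (Finset.mem_univ i)

theorem isGeneric_imp {c : Prop} {p : (V → ℝ) → Prop} (h : c → IsGeneric p) :
    IsGeneric fun x => c → p x := by
  by_cases hc : c
  · exact (h hc).mono fun x hx _ => hx
  · exact .of_forall fun x h => absurd h hc

theorem isGeneric_ne_zero {g : (V → ℝ) → ℝ} (H : MvPolynomial V ℝ)
    (hH : ∀ x, MvPolynomial.eval x H = g x) (x : V → ℝ) (hx : g x ≠ 0) :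
    IsGeneric fun x => g x ≠ 0 := by
  refine ⟨H, ?_, fun x hx h => hx ((hH x).trans h)⟩
  rintro rfl
  exact hx (by rw [← hH, map_zero])

end Generic

/-! ### Generic bound on incidences by parameter counting -/

section Tight

variable {m n : ℕ} {R : Type*} [CommRing R]

/-- The index type of the entries of a pair of matrices. -/
abbrev Entry (m n : ℕ) : Type := (Fin m × Fin 2) ⊕ (Fin n × Fin 2)

/-- The determinant of two plane vectors. -/
def det₂ (u v : Fin 2 → R) : R := u 0 * v 1 - u 1 * v 0

/-- The unit vectors together with the rows of a matrix. -/
def unitsAndRows (a : Fin n × Fin 2 → R) : Fin 2 ⊕ Fin n → Fin 2 → R :=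
  Sum.elim (fun k l => if k = l then 1 else 0) (fun j l => a (j, l))

theorem map_unitsAndRows {S : Type*} [CommRing S] (φ : R →+* S) (a : Fin n × Fin 2 → R)
    (c : Fin 2 ⊕ Fin n) (l : Fin 2) :
    φ (unitsAndRows a c l) = unitsAndRows (φ ∘ a) c l := by
  rcases c with k | j
  · simp only [unitsAndRows, Sum.elim_inl]
    split_ifs <;> simp
  · rfl

theorem map_det₂ {S : Type*} [CommRing S] (φ : R →+* S) (u v : Fin 2 → R) :
    φ (det₂ u v) = det₂ (φ ∘ u) (φ ∘ v) := by
  simp [det₂]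

/-- A generic vector of matrix entries whose second matrix has its rows on a parabola. -/
def parabola (m n : ℕ) : Entry m n → ℝ :=
  Sum.elim 0 fun u => if u.2 = 0 then (u.1 : ℝ) + 1 else ((u.1 : ℝ) + 1) ^ 2

/-- This makes Cramer's rule available for locating image points. On the parabola, `(t, t ^ 2)` and
`(u, u ^ 2)` have determinant `t * u * (u - t)`; the parameters start at 1 so that no row is zero or
parallel to a unit vector. -/
theorem isGeneric_det₂_ne_zero (c d : Fin 2 ⊕ Fin n) (hcd : c ≠ d) :
    IsGeneric fun x : Entry m n → ℝ =>
      det₂ (unitsAndRows (fun u => x (.inr u)) c) (unitsAndRows (fun u => x (.inr u)) d) ≠ 0 := by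
  refine isGeneric_ne_zero (det₂ (unitsAndRows (fun u => .X (.inr u)) c)
    (unitsAndRows (fun u => .X (.inr u)) d)) (fun x => ?_) (parabola m n) ?_
  · rw [map_det₂]
    congr 1 <;> ext l <;> simp [map_unitsAndRows, Function.comp_def]
  · have hpos : ∀ j : Fin n, (0 : ℝ) < (j : ℝ) + 1 := fun j => by positivity
    rcases c with k | i <;> rcases d with l | j
    · fin_cases k <;> fin_cases l <;> simp [det₂, unitsAndRows] at hcd ⊢
    · fin_cases k <;> simp [det₂, unitsAndRows, parabola, (hpos j).ne']
      linarith [hpos j]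
    · fin_cases l <;> simp [det₂, unitsAndRows, parabola, (hpos i).ne']
    · have hij : (i : ℝ) ≠ j := fun h => hcd (by rw [Fin.ext (Nat.cast_injective h)])
      have : det₂ (unitsAndRows (fun u => parabola m n (.inr u)) (.inr i))
          (unitsAndRows (fun u => parabola m n (.inr u)) (.inr j)) =
          ((i : ℝ) + 1) * ((j : ℝ) + 1) * ((j : ℝ) - i) := by
        simp [det₂, unitsAndRows, parabola]
        ring
      rw [this]
      exact mul_ne_zero (mul_pos (hpos i) (hpos j)).ne' (sub_ne_zero.2 hij.symm)

/-- By duality, lines `row = 1` with a common point come from collinear rows, and no three points of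
a parabola are collinear. -/
theorem isGeneric_not_concurrent (i j k : Fin n) (hij : i ≠ j) (hik : i ≠ k) (hjk : j ≠ k) :
    IsGeneric fun x : Entry m n → ℝ =>
      (x (.inr (j, 0)) - x (.inr (i, 0))) * (x (.inr (k, 1)) - x (.inr (i, 1))) -
        (x (.inr (j, 1)) - x (.inr (i, 1))) * (x (.inr (k, 0)) - x (.inr (i, 0))) ≠ 0 := by
  refine isGeneric_ne_zero
    ((.X (.inr (j, 0)) - .X (.inr (i, 0))) * (.X (.inr (k, 1)) - .X (.inr (i, 1))) -
        (.X (.inr (j, 1)) - .X (.inr (i, 1))) * (.X (.inr (k, 0)) - .X (.inr (i, 0))))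
    (fun x => by simp) (parabola m n) ?_
  have h : ∀ a b : Fin n, a ≠ b → (b : ℝ) - a ≠ 0 := fun a b hab h =>
    hab (Fin.ext (Nat.cast_injective (sub_eq_zero.1 h).symm))
  have := mul_ne_zero (mul_ne_zero (h i j hij) (h i k hik)) (h j k hjk)
  convert this using 1
  simp [parabola]
  ring

/-- For a set of at most two indices there are two distinct vectors among the unit vectors and the
rows of a matrix which include all the rows with index in the set and no others. -/
theorem exists_slots (S : Finset (Fin n)) (hS : S.card ≤ 2) :
    ∃ s : Fin 2 → Fin 2 ⊕ Fin n, s 0 ≠ s 1 ∧ (∀ k j, s k = .inr j → j ∈ S) ∧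
      S.card = Fintype.card {k // (s k).isRight} := by
  have h : S.card = 0 ∨ S.card = 1 ∨ S.card = 2 := by omega
  rcases h with h | h | h
  · refine ⟨![.inl 0, .inl 1], by simp, ?_, ?_⟩
    · intro k j; fin_cases k <;> simp
    · rw [h, eq_comm, Fintype.card_eq_zero_iff]
      constructor
      rintro ⟨k, hk⟩
      fin_cases k <;> simp at hk
  · obtain ⟨j, rfl⟩ := Finset.card_eq_one.1 h
    refine ⟨![.inr j, .inl 0], by simp, ?_, ?_⟩
    · intro k j; fin_cases k <;> simp [eq_comm]
    · rw [h, eq_comm, Fintype.card_eq_one_iff]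
      refine ⟨⟨0, by simp⟩, ?_⟩
      rintro ⟨k, hk⟩
      fin_cases k <;> simp at hk ⊢
  · obtain ⟨i, j, hij, rfl⟩ := Finset.card_eq_two.1 h
    refine ⟨![.inr i, .inr j], by simpa using hij, ?_, ?_⟩
    · intro k j; fin_cases k <;> simp +contextual [eq_comm]
    · rw [h, eq_comm, Fintype.card_of_subtype Finset.univ]
      · simp
      · intro k; fin_cases k <;> simp

/-- The variables that parametrize the pairs of matrices with a prescribed pattern of incidences:
the coefficients of an affine map, the entries of the second matrix, and the free coordinates. -/
abbrev Param (s : Fin m → Fin 2 → Fin 2 ⊕ Fin n) : Type :=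
  (Fin 2 × Fin 3) ⊕ (Fin n × Fin 2) ⊕ {u : Fin m × Fin 2 // ¬ (s u.1 u.2).isRight}

/-- Here `g` plays the inverse of the affine map and `q` the image points. A pattern with more than
six incidences leaves fewer parameters than matrix entries, so the pairs realizing it satisfy a
fixed nonzero polynomial relation. -/
theorem isGeneric_not_incident (s : Fin m → Fin 2 → Fin 2 ⊕ Fin n)
    (hs : 6 < ∑ i, Fintype.card {k // (s i k).isRight}) :
    IsGeneric fun x : Entry m n → ℝ => ∀ (q : Fin m → Fin 2 → ℝ) (g : Fin 2 → Fin 3 → ℝ),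
      (∀ i k, x (.inl (i, k)) = g k 0 * q i 0 + g k 1 * q i 1 + g k 2) →
      (∀ i, det₂ (unitsAndRows (fun u => x (.inr u)) (s i 0))
        (unitsAndRows (fun u => x (.inr u)) (s i 1)) ≠ 0) →
      ∃ i k j, s i k = .inr j ∧ x (.inr (j, 0)) * q i 0 + x (.inr (j, 1)) * q i 1 ≠ 1 := by
  classical
  -- The point `q i` is determined by the two equations `W i k · q i = r i k`: the right side is 1
  -- for a row of `M'`, and a free variable for a unit vector, which reads off a coordinate.
  let W : Fin m → Fin 2 → Fin 2 → MvPolynomial (Param s) ℝ := fun i k =>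
    unitsAndRows (fun u => .X (.inr (.inl u))) (s i k)
  let r : Fin m → Fin 2 → MvPolynomial (Param s) ℝ := fun i k =>
    if h : (s i k).isRight then 1 else .X (.inr (.inr ⟨(i, k), h⟩))
  let G : Fin 2 → Fin 3 → MvPolynomial (Param s) ℝ := fun k l => .X (.inl (k, l))
  let d : Fin m → MvPolynomial (Param s) ℝ := fun i => det₂ (W i 0) (W i 1)
  have hcard : Fintype.card (Param s) < Fintype.card (Entry m n) := by
    have h1 : Fintype.card {u : Fin m × Fin 2 // (s u.1 u.2).isRight} =
        ∑ i, Fintype.card {k // (s i k).isRight} := by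
      rw [← Fintype.card_sigma]
      exact Fintype.card_congr
        ⟨fun u => ⟨u.1.1, u.1.2, u.2⟩, fun u => ⟨(u.1, u.2.1), u.2.2⟩, fun _ => rfl, fun _ => rfl⟩
    have h2 := Fintype.card_subtype_compl fun u : Fin m × Fin 2 => (s u.1 u.2).isRight
    have h3 := Fintype.card_subtype_le fun u : Fin m × Fin 2 => (s u.1 u.2).isRight
    simp only [Entry, Param, Fintype.card_sum, Fintype.card_prod, Fintype.card_fin] at *
    omega
  obtain ⟨H, hH0, hH⟩ := exists_relation_of_card_lt hcard
    -- Cramer's rule for `q i`, with common denominator `d i`, substituted into the affine map with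
    -- coefficients `G`; the entries of `M'` are parameters themselves.
    (Sum.elim (fun u => G u.2 0 * (r u.1 0 * W u.1 1 1 - r u.1 1 * W u.1 0 1) +
        G u.2 1 * (W u.1 0 0 * r u.1 1 - W u.1 1 0 * r u.1 0) + G u.2 2 * d u.1)
      (fun u => .X (.inr (.inl u))))
    (Sum.elim (fun u => d u.1) 1)
  refine ⟨H, hH0, fun x hx q g hq hd => ?_⟩
  by_contra! hinc
  let a : Fin n × Fin 2 → ℝ := fun u => x (.inr u)
  let w : Fin m → Fin 2 → Fin 2 → ℝ := fun i k => unitsAndRows a (s i k)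
  -- The parameter values that reproduce the given pair `x`.
  let c : Param s → ℝ := Sum.elim (fun u => g u.1 u.2) (Sum.elim a fun u =>
    w u.1.1 u.1.2 0 * q u.1.1 0 + w u.1.1 u.1.2 1 * q u.1.1 1)
  have hW : ∀ i k l, MvPolynomial.eval c (W i k l) = w i k l := fun i k l => by
    simp [W, w, map_unitsAndRows, Function.comp_def, c]
  have hG : ∀ k l, MvPolynomial.eval c (G k l) = g k l := fun k l => by simp [G, c]
  have hdet : ∀ i, MvPolynomial.eval c (d i) = det₂ (w i 0) (w i 1) := fun i => by
    simp only [d, map_det₂]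
    congr 1 <;> ext l <;> exact hW _ _ _
  have hr : ∀ i k, MvPolynomial.eval c (r i k) = w i k 0 * q i 0 + w i k 1 * q i 1 := by
    intro i k
    by_cases h : (s i k).isRight
    · obtain ⟨j, hj⟩ := Sum.isRight_iff.1 h
      simp only [r, h, dite_true, map_one]
      rw [← hinc i k j hj]
      simp [w, hj, unitsAndRows, a]
    · simp [r, h, c]
  refine hx ?_
  refine (congrArg (fun y => MvPolynomial.eval y H) (funext fun v => ?_)).trans (hH c ?_)
  · rcases v with ⟨i, k⟩ | u
    · simp only [Sum.elim_inl]
      rw [eq_div_iff (by rw [hdet]; exact hd i), hq]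
      simp only [map_add, map_mul, map_sub, hG, hr, hW, hdet, det₂]
      ring
    · simp [c, a]
  · rintro (⟨i, k⟩ | u)
    · simp only [Sum.elim_inl, hdet]
      exact hd i
    · simp

/-- The entries of a pair of matrices. -/
def entries (M : Matrix (Fin 2) (Fin m) ℝ) (M' : Matrix (Fin n) (Fin 2) ℝ) : Entry m n → ℝ :=
  Sum.elim (fun u => M u.2 u.1) fun u => M' u.1 u.2

theorem exists_affine_coeffs (g : (Fin 2 → ℝ) →ᵃ[ℝ] (Fin 2 → ℝ)) :
    ∃ c : Fin 2 → Fin 3 → ℝ, ∀ x k, g x k = c k 0 * x 0 + c k 1 * x 1 + c k 2 := by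
  refine ⟨fun k => ![g.linear (Pi.single 0 1) k, g.linear (Pi.single 1 1) k, g 0 k],
    fun x k => ?_⟩
  have hx : x = x 0 • Pi.single 0 1 + x 1 • Pi.single 1 1 := by
    ext l; fin_cases l <;> simp
  have hlin : g.linear x =
      x 0 • g.linear (Pi.single 0 1) + x 1 • g.linear (Pi.single 1 1) := by
    conv_lhs => rw [hx, map_add, map_smul, map_smul]
  rw [g.decomp, Pi.add_apply, hlin]
  simp [mul_comm]

/-- For generic `M` and `M'`, a bijective affine map sends columns of `M` to at most six incidences
with the lines defined by the rows of `M'`. -/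
theorem isGeneric_card_tight_le (m n : ℕ) :
    IsGeneric fun x : Entry m n → ℝ => ∀ f : (Fin 2 → ℝ) →ᵃ[ℝ] (Fin 2 → ℝ),
      Function.Bijective f → ∀ T : Finset (Fin m × Fin n),
      (∀ u ∈ T, x (.inr (u.2, 0)) * f (fun k => x (.inl (u.1, k))) 0 +
        x (.inr (u.2, 1)) * f (fun k => x (.inl (u.1, k))) 1 = 1) → T.card ≤ 6 := by
  classical
  have h1 : IsGeneric fun x : Entry m n → ℝ => ∀ c d : Fin 2 ⊕ Fin n, c ≠ d →
      det₂ (unitsAndRows (fun u => x (.inr u)) c) (unitsAndRows (fun u => x (.inr u)) d) ≠ 0 :=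
    isGeneric_all fun c => isGeneric_all fun d => isGeneric_imp (isGeneric_det₂_ne_zero c d)
  have h2 := isGeneric_all fun i : Fin n => isGeneric_all fun j => isGeneric_all fun k =>
    isGeneric_imp fun hij : i ≠ j => isGeneric_imp fun hik : i ≠ k =>
      isGeneric_imp (isGeneric_not_concurrent (m := m) i j k hij hik)
  have h3 := isGeneric_all fun s : Fin m → Fin 2 → Fin 2 ⊕ Fin n =>
    isGeneric_imp (isGeneric_not_incident s)
  refine ((h1.and h2).and h3).mono ?_
  rintro x ⟨⟨h1, h2⟩, h3⟩ f hf T hT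
  let q : Fin m → Fin 2 → ℝ := fun i => f fun k => x (.inl (i, k))
  let S : Fin m → Finset (Fin n) := fun i => {j | (i, j) ∈ T}
  have hSq : ∀ i, ∀ j ∈ S i, x (.inr (j, 0)) * q i 0 + x (.inr (j, 1)) * q i 1 = 1 :=
    fun i j hj => hT (i, j) (by simpa [S] using hj)
  have hS : ∀ i, (S i).card ≤ 2 := by
    intro i
    by_contra! h
    obtain ⟨a, b, c, ha, hb, hc, hab, hac, hbc⟩ := Finset.two_lt_card_iff.1 h
    have ea := hSq i a ha
    have eb := hSq i b hb
    have ec := hSq i c hc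
    refine h2 a b c hab hac hbc ?_
    -- Subtracting the three incidence equations gives `D * q i = 0`; pairing this with row `a`,
    -- which takes the value 1 at `q i`, gives `D = 0`.
    set D := (x (.inr (b, 0)) - x (.inr (a, 0))) * (x (.inr (c, 1)) - x (.inr (a, 1))) -
        (x (.inr (b, 1)) - x (.inr (a, 1))) * (x (.inr (c, 0)) - x (.inr (a, 0))) with hD
    have e0 : D * q i 0 = 0 := by
      rw [hD]
      linear_combination (x (.inr (c, 1)) - x (.inr (a, 1))) * (eb - ea) -
        (x (.inr (b, 1)) - x (.inr (a, 1))) * (ec - ea)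
    have e1 : D * q i 1 = 0 := by
      rw [hD]
      linear_combination (x (.inr (b, 0)) - x (.inr (a, 0))) * (ec - ea) -
        (x (.inr (c, 0)) - x (.inr (a, 0))) * (eb - ea)
    linear_combination (-D) * ea + x (.inr (a, 0)) * e0 + x (.inr (a, 1)) * e1
  choose s hs0 hs1 hs2 using fun i => exists_slots (S i) (hS i)
  have hcard : T.card = ∑ i, (S i).card := by
    rw [Finset.card_eq_sum_card_fiberwise (f := Prod.fst) (t := Finset.univ) (by simp)]
    refine Finset.sum_congr rfl fun i _ => ?_
    refine Finset.card_nbij' (fun u => u.2) (fun j => (i, j)) ?_ ?_ ?_ ?_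
    · rintro ⟨i', j⟩ h
      simp only [Finset.coe_filter, Set.mem_ofPred_eq] at h
      obtain ⟨h, rfl⟩ := h
      simpa [S] using h
    · intro j hj
      simpa [S] using hj
    · rintro ⟨i', j⟩ h
      simp only [Finset.coe_filter, Set.mem_ofPred_eq] at h
      obtain ⟨h, rfl⟩ := h
      rfl
    · intro j hj
      rfl
  by_contra! hlt
  -- Bijectivity of `f` enters here: the columns of `M` are recovered from their images by the
  -- inverse map.
  obtain ⟨g, hg⟩ := exists_affine_coeffs (AffineEquiv.ofBijective hf).symm.toAffineMap
  obtain ⟨i, k, j, hj, hne⟩ := h3 s (by simpa only [hcard, hs2] using hlt) q g (fun i k => by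
    rw [← hg (q i) k]
    exact (congrFun ((AffineEquiv.ofBijective hf).symm_apply_apply fun l => x (.inl (i, l))) k).symm)
    (fun i => h1 _ _ (hs0 i))
  exact hne (hSq i j (hs1 i k j hj))

end Tight

/-! ### Openness of the realization spaces -/

section Realizations

open Topology Filter

theorem convexHull_range_eq_image_stdSimplex {ι E : Type*} [Fintype ι] [AddCommGroup E]
    [Module ℝ E] (p : ι → E) :
    convexHull ℝ (Set.range p) = (fun w : ι → ℝ => ∑ i, w i • p i) '' stdSimplex ℝ ι := by
  classical
  have : (fun w : ι → ℝ => ∑ i, w i • p i) = Fintype.linearCombination ℝ p := by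
    ext w
    simp [Fintype.linearCombination_apply]
  rw [this, ← convexHull_basis_eq_stdSimplex, LinearMap.image_convexHull, ← Set.range_comp]
  congr 2
  ext i
  simp [Fintype.linearCombination_apply]

theorem convexIndependent_iff_sum_ne {ι E : Type*} [Fintype ι] [DecidableEq ι] [AddCommGroup E]
    [Module ℝ E] (p : ι → E) :
    ConvexIndependent ℝ p ↔
      ∀ i, ∀ w ∈ stdSimplex ℝ {k // k ≠ i}, ∑ k, w k • p k ≠ p i := by
  rw [convexIndependent_iff_notMem_convexHull_sdiff]
  have h : ∀ i, p '' (Set.univ \ {i}) = Set.range fun k : {k // k ≠ i} => p k := by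
    intro i
    ext x
    simp
  constructor
  · rintro hp i w hw hsum
    refine hp i Set.univ ?_
    rw [h, convexHull_range_eq_image_stdSimplex]
    exact ⟨w, hw, hsum⟩
  · intro hp i s hi
    have := convexHull_mono (Set.image_mono (Set.sdiff_subset_sdiff_left (Set.subset_univ s))) hi
    rw [h, convexHull_range_eq_image_stdSimplex] at this
    obtain ⟨w, hw, hsum⟩ := this
    exact hp i w hw hsum

/-- The weights range over compact simplices, so the nonequalities of `convexIndependent_iff_sum_ne`
persist near `M`. -/
theorem isOpen_convexIndependent (d m : ℕ) :
    IsOpen {M : Matrix (Fin d) (Fin m) ℝ | ConvexIndependent ℝ M.col} := by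
  simp only [convexIndependent_iff_sum_ne, Set.ofPred_forall]
  refine isOpen_iInter_of_finite fun i => ?_
  simp only [← Set.ofPred_forall]
  rw [isOpen_iff_eventually]
  intro M hM
  refine (isCompact_stdSimplex ℝ {k // k ≠ i}).eventually_forall_of_forall_eventually fun w hw => ?_
  have hcol : ∀ k, Continuous fun z : Matrix (Fin d) (Fin m) ℝ × ({k // k ≠ i} → ℝ) => z.1.col k :=
    fun k => continuous_pi fun l => (continuous_fst.matrix_elem l k)
  have hc : Continuous fun z : Matrix (Fin d) (Fin m) ℝ × ({k // k ≠ i} → ℝ) =>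
      ∑ k : {k // k ≠ i}, z.2 k • z.1.col k :=
    continuous_finsetSum _ fun k _ => ((continuous_apply k).comp continuous_snd).smul (hcol k)
  exact (isOpen_ne_fun hc (hcol i)).mem_nhds (hM w hw)

/-- Of three collinear points one lies between the other two, so any three points in convex position
already span the plane. -/
theorem ConvexIndependent.affineSpan_eq_top {m : ℕ} (hm : 3 ≤ m) {p : Fin m → Fin 2 → ℝ}
    (hp : ConvexIndependent ℝ p) : affineSpan ℝ (Set.range p) = ⊤ := by
  let e : Fin 3 ↪ Fin m := (Fin.castLEEmb hm)
  have hq : ConvexIndependent ℝ (p ∘ e) := hp.comp_embedding e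
  have hnot : ∀ i j k, i ≠ j → i ≠ k → (p ∘ e) i ∉ segment ℝ ((p ∘ e) j) ((p ∘ e) k) := by
    intro i j k hij hik hmem
    rw [← convexHull_pair, ← Set.image_pair, hq.mem_convexHull_iff] at hmem
    rcases hmem with h | h
    · exact hij h
    · exact hik h
  have hind : AffineIndependent ℝ (p ∘ e) := by
    rw [affineIndependent_iff_not_collinear, show Set.range (p ∘ e) =
      {(p ∘ e) 0, (p ∘ e) 1, (p ∘ e) 2} by
        ext x; simp [Fin.exists_fin_succ, eq_comm]]
    intro h
    rcases h.wbtw_or_wbtw_or_wbtw with h | h | h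
    · exact hnot 1 0 2 (by decide) (by decide) h.mem_segment
    · exact hnot 2 1 0 (by decide) (by decide) h.mem_segment
    · exact hnot 0 2 1 (by decide) (by decide) h.mem_segment
  have htop := hind.affineSpan_eq_top_iff_card_eq_finrank_add_one.2 (by simp)
  rw [eq_top_iff, ← htop]
  exact affineSpan_mono ℝ (Set.range_comp_subset_range _ _)

theorem isOpen_realizationR {m : ℕ} (hm : 3 ≤ m) : IsOpen (realizationR 2 m) := by
  convert isOpen_convexIndependent 2 m using 1
  ext M
  exact ⟨fun h => h.1, fun h => ⟨h, ConvexIndependent.affineSpan_eq_top hm h⟩⟩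

variable {n e : ℕ}

/-- The linear functionals given by the rows of a matrix. -/
def rowFunctional (A : Matrix (Fin n) (Fin e) ℝ) (j : Fin n) : (Fin e → ℝ) →ₗ[ℝ] ℝ :=
  LinearMap.proj j ∘ₗ A.mulVecLin

@[simp]
theorem rowFunctional_apply (A : Matrix (Fin n) (Fin e) ℝ) (j : Fin n) (x : Fin e → ℝ) :
    rowFunctional A j x = (A *ᵥ x) j := rfl

theorem polyQ_eq_polyhedron (A : Matrix (Fin n) (Fin e) ℝ) :
    polyQ A = polyhedron (rowFunctional A) := rfl

/-- Boundedness means that no ray from the origin stays in the polyhedron; stated on the compact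
sphere, this is visibly an open condition on `A`. -/
theorem isBounded_polyQ_iff (A : Matrix (Fin n) (Fin e) ℝ) :
    Bornology.IsBounded (polyQ A) ↔
      ∀ x ∈ Metric.sphere (0 : Fin e → ℝ) 1, ∃ j, 0 < (A *ᵥ x) j := by
  constructor
  · intro hb x hx
    by_contra! h
    obtain ⟨r, hr⟩ := hb.exists_norm_le
    have hmem : (|r| + 1) • x ∈ polyQ A := by
      intro j
      rw [Matrix.mulVec_smul]
      have : (|r| + 1) * (A *ᵥ x) j ≤ 0 := mul_nonpos_of_nonneg_of_nonpos (by positivity) (h j)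
      simpa using this.trans zero_le_one
    have := hr _ hmem
    rw [norm_smul, mem_sphere_zero_iff_norm.1 hx, Real.norm_of_nonneg (by positivity)] at this
    linarith [le_abs_self r]
  · intro h
    -- `g` is positively homogeneous, at most `n` on the polyhedron, and has a positive minimum on
    -- the sphere, which bounds the norm. The sphere is empty when `e = 0`.
    let g : (Fin e → ℝ) → ℝ := fun x => ∑ j, max 0 ((A *ᵥ x) j)
    have hg : Continuous g := by
      refine continuous_finsetSum _ fun j _ => continuous_const.max ?_
      exact (continuous_apply j).comp (continuous_const.matrix_mulVec continuous_id)
    rcases (Metric.sphere (0 : Fin e → ℝ) 1).eq_empty_or_nonempty with hemp | hne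
    · have : ∀ y : Fin e → ℝ, y = 0 := by
        intro y
        by_contra hy
        have : (‖y‖⁻¹ • y) ∈ Metric.sphere (0 : Fin e → ℝ) 1 := by simp [norm_smul, hy]
        simp [hemp] at this
      exact (Bornology.isBounded_singleton (x := (0 : Fin e → ℝ))).subset fun y _ => this y
    obtain ⟨x₀, hx₀, hmin⟩ := (isCompact_sphere (0 : Fin e → ℝ) 1).exists_isMinOn hne hg.continuousOn
    have hpos : 0 < g x₀ := by
      obtain ⟨j, hj⟩ := h x₀ hx₀
      exact Finset.sum_pos' (fun _ _ => le_max_left _ _)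
        ⟨j, Finset.mem_univ j, lt_max_of_lt_right hj⟩
    refine isBounded_iff_forall_norm_le.2 ⟨n / g x₀, fun y hy => ?_⟩
    rcases eq_or_ne y 0 with rfl | hy0
    · rw [norm_zero]
      positivity
    have hn : 0 < ‖y‖ := norm_pos_iff.2 hy0
    have h1 : g x₀ ≤ g (‖y‖⁻¹ • y) := hmin (by simp [norm_smul, hy0])
    have h2 : g (‖y‖⁻¹ • y) = ‖y‖⁻¹ * g y := by
      simp only [g, Matrix.mulVec_smul, Pi.smul_apply, smul_eq_mul, Finset.mul_sum]
      refine Finset.sum_congr rfl fun j _ => ?_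
      rw [mul_max_of_nonneg _ _ (by positivity), mul_zero]
    have h3 : g y ≤ n := by
      have : g y ≤ ∑ _j : Fin n, (1 : ℝ) :=
        Finset.sum_le_sum fun j _ => max_le zero_le_one (hy j)
      simpa using this
    rw [le_div_iff₀ hpos]
    calc ‖y‖ * g x₀ ≤ ‖y‖ * (‖y‖⁻¹ * g y) := by rw [← h2]; gcongr
      _ = g y := by field_simp
      _ ≤ n := h3

theorem isOpen_isBounded_polyQ :
    IsOpen {A : Matrix (Fin n) (Fin e) ℝ | Bornology.IsBounded (polyQ A)} := by
  simp only [isBounded_polyQ_iff]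
  rw [isOpen_iff_eventually]
  intro A hA
  refine (isCompact_sphere _ _).eventually_forall_of_forall_eventually fun x hx => ?_
  obtain ⟨j, hj⟩ := hA x hx
  have hc : Continuous fun z : Matrix (Fin n) (Fin e) ℝ × (Fin e → ℝ) => (z.1 *ᵥ z.2) j :=
    (continuous_apply j).comp (continuous_fst.matrix_mulVec continuous_snd)
  filter_upwards [(isOpen_lt continuous_const hc).mem_nhds hj] with z hz using ⟨j, hz⟩

/-- Rescaling `x` so that row `s` takes the value 1 passes between the two sides; for fixed `x` the
right side consists of strict inequalities, open in `A`. -/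
theorem exists_irredundant_iff (A : Matrix (Fin n) (Fin e) ℝ) (s : Fin n) :
    (∃ x ∈ polyQ A, (A *ᵥ x) s = 1 ∧ ∀ t, (A *ᵥ x) t = 1 → t = s) ↔
      ∃ x, 0 < (A *ᵥ x) s ∧ ∀ t, t ≠ s → (A *ᵥ x) t < (A *ᵥ x) s := by
  constructor
  · rintro ⟨x, hx, hs, ht⟩
    refine ⟨x, hs ▸ one_pos, fun t hts => ?_⟩
    rw [hs]
    exact lt_of_le_of_ne (hx t) fun h => hts (ht t h)
  · rintro ⟨x, hs, ht⟩
    have key : ∀ t, (A *ᵥ (((A *ᵥ x) s)⁻¹ • x)) t = (A *ᵥ x) t / (A *ᵥ x) s := fun t => by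
      rw [Matrix.mulVec_smul, Pi.smul_apply, smul_eq_mul, inv_mul_eq_div]
    have hlt : ∀ t, t ≠ s → (A *ᵥ x) t / (A *ᵥ x) s < 1 := fun t h => by
      rw [div_lt_one hs]
      exact ht t h
    refine ⟨((A *ᵥ x) s)⁻¹ • x, fun t => ?_, ?_, fun t h => ?_⟩
    · rw [key, Pi.one_apply]
      rcases eq_or_ne t s with rfl | h
      · rw [div_self hs.ne']
      · exact (hlt t h).le
    · rw [key, div_self hs.ne']
    · by_contra hne
      rw [key] at h
      exact (hlt t hne).ne h

theorem realizationR'_eq :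
    realizationR' e n = {A | Bornology.IsBounded (polyQ A)} ∩
      ⋂ s, {A | ∃ x, 0 < (A *ᵥ x) s ∧ ∀ t, t ≠ s → (A *ᵥ x) t < (A *ᵥ x) s} := by
  ext A
  have h := encard_facets_eq_iff (rowFunctional A)
  rw [← polyQ_eq_polyhedron, Fintype.card_fin] at h
  have hd : affDim (polyQ A) = e := by
    rw [polyQ_eq_polyhedron, affDim_polyhedron, Module.finrank_fin_fun]
  simp only [realizationR', Set.mem_inter_iff, Set.mem_iInter, Set.mem_ofPred_eq, hd, true_and]
  refine and_congr_right fun _ => h.trans (forall_congr' fun s => ?_)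
  exact exists_irredundant_iff A s

theorem isOpen_realizationR' : IsOpen (realizationR' e n) := by
  rw [realizationR'_eq]
  refine isOpen_isBounded_polyQ.inter (isOpen_iInter_of_finite fun s => ?_)
  simp only [Set.ofPred_exists]
  refine isOpen_iUnion fun x => ?_
  have hc : ∀ t, Continuous fun A : Matrix (Fin n) (Fin e) ℝ => (A *ᵥ x) t := fun t =>
    (continuous_apply t).comp (continuous_id.matrix_mulVec continuous_const)
  refine (isOpen_lt continuous_const (hc s)).and ?_
  simp only [Set.ofPred_forall]
  exact isOpen_iInter_of_finite fun t => isOpen_iInter_of_finite fun _ => isOpen_lt (hc t) (hc s)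

end Realizations

/-! ### The hom-polytope as a polyhedron -/

section HomPolyhedron

variable {m n d e : ℕ}

/-- The value of an affine map at a column of `M`, paired with a row of `M'`. -/
def pairing (M : Matrix (Fin d) (Fin m) ℝ) (M' : Matrix (Fin n) (Fin e) ℝ) (u : Fin m × Fin n) :
    ((Fin d → ℝ) →ᵃ[ℝ] (Fin e → ℝ)) →ₗ[ℝ] ℝ where
  toFun f := (M' *ᵥ f (M.col u.1)) u.2
  map_add' f g := by simp [Matrix.mulVec_add]
  map_smul' c f := by simp [Matrix.mulVec_smul]

theorem homSet_eq_polyhedron (M : Matrix (Fin d) (Fin m) ℝ) (M' : Matrix (Fin n) (Fin e) ℝ) :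
    homSet (polyP M) (polyQ M') = polyhedron (pairing M M') := by
  ext f
  constructor
  · intro hf u
    exact hf (subset_convexHull ℝ _ ⟨u.1, rfl⟩) u.2
  · intro hf
    have hconv : Convex ℝ (polyQ M') := by
      intro x hx y hy a b ha hb hab j
      have h1 := mul_le_mul_of_nonneg_left (hx j) ha
      have h2 := mul_le_mul_of_nonneg_left (hy j) hb
      simp only [Matrix.mulVec_add, Matrix.mulVec_smul, Pi.add_apply, Pi.smul_apply, smul_eq_mul,
        Pi.one_apply] at h1 h2 ⊢
      linarith
    refine convexHull_min ?_ (hconv.affine_preimage f)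
    rintro _ ⟨i, rfl⟩ j
    exact hf (i, j)

/-- The directions of the image lie in the range of the linear part, which is therefore everything.
-/
theorem bijective_of_affDim_image (f : (Fin d → ℝ) →ᵃ[ℝ] (Fin d → ℝ)) (P : Set (Fin d → ℝ))
    (h : affDim (f '' P) = d) : Function.Bijective f := by
  have htop : LinearMap.range f.linear = ⊤ := by
    refine Submodule.eq_top_of_finrank_eq (le_antisymm (Submodule.finrank_le _) ?_)
    rw [affDim, ← AffineMap.map_vectorSpan] at h
    rw [Module.finrank_fin_fun]
    conv_lhs => rw [← h]
    exact Submodule.finrank_mono LinearMap.map_le_range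
  have hs := LinearMap.range_eq_top.1 htop
  exact f.linear_bijective_iff.1 ⟨LinearMap.injective_iff_surjective.2 hs, hs⟩

/-- The pair of matrices with given entries. -/
def ofEntries (x : Entry m n → ℝ) : Matrix (Fin 2) (Fin m) ℝ × Matrix (Fin n) (Fin 2) ℝ :=
  (Matrix.of fun k i => x (.inl (i, k)), Matrix.of fun j k => x (.inr (j, k)))

theorem continuous_entries :
    Continuous fun p : Matrix (Fin 2) (Fin m) ℝ × Matrix (Fin n) (Fin 2) ℝ => entries p.1 p.2 := by
  refine continuous_pi ?_
  rintro (u | u)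
  · exact continuous_fst.matrix_elem _ _
  · exact continuous_snd.matrix_elem _ _

theorem continuous_ofEntries : Continuous (ofEntries (m := m) (n := n)) :=
  (continuous_matrix fun k i => continuous_apply (Sum.inl (i, k))).prodMk
    (continuous_matrix fun j k => continuous_apply (Sum.inr (j, k)))

end HomPolyhedron

end HomPolytope

/-! ### The main theorem -/

theorem mainTheorem1 (m n : ℕ) (hm : 3 ≤ m) (hn : 3 ≤ n) :
    ∃ U : Set (HomPolytope.realizationR 2 m × HomPolytope.realizationR' 2 n),
      IsOpen U ∧ Dense U ∧
      ∀ p ∈ U,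
        HomPolytope.affDim
          (HomPolytope.homSet (HomPolytope.polyP p.1.1) (HomPolytope.polyQ p.2.1)) = 6 ∧
        ∀ f ∈ Set.extremePoints ℝ
            (HomPolytope.homSet (HomPolytope.polyP p.1.1) (HomPolytope.polyQ p.2.1)),
          HomPolytope.affDim (f '' HomPolytope.polyP p.1.1) = 2 →
          HomPolytope.IsSimpleVertex
            (HomPolytope.homSet (HomPolytope.polyP p.1.1) (HomPolytope.polyQ p.2.1)) f := by
  classical
  obtain ⟨H, hH0, hH⟩ := HomPolytope.isGeneric_card_tight_le m n
  refine ⟨{p | MvPolynomial.eval (HomPolytope.entries p.1.1 p.2.1) H ≠ 0}, ?_, ?_, ?_⟩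
  · refine isOpen_ne_fun ?_ continuous_const
    exact (MvPolynomial.continuous_eval H).comp (HomPolytope.continuous_entries.comp
      (continuous_subtype_val.prodMap continuous_subtype_val))
  · rw [dense_iff_inter_open]
    rintro O hO ⟨p, hp⟩
    -- Since both realization spaces are open, a relatively open set of pairs is open among all
    -- pairs of matrices, where `H` cannot vanish identically.
    have hopen := ((HomPolytope.isOpen_realizationR hm).isOpenMap_subtype_val.prodMap
      (HomPolytope.isOpen_realizationR' (e := 2) (n := n)).isOpenMap_subtype_val) O hO
    obtain ⟨x, ⟨r, hr, hrx⟩, hx⟩ := HomPolytope.exists_mem_eval_ne_zero hH0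
      (hopen.preimage HomPolytope.continuous_ofEntries)
      ⟨HomPolytope.entries p.1.1 p.2.1, p, hp, rfl⟩
    refine ⟨r, hr, ?_⟩
    have h1 : r.1.1 = (HomPolytope.ofEntries x).1 := congrArg Prod.fst hrx
    have h2 : r.2.1 = (HomPolytope.ofEntries x).2 := congrArg Prod.snd hrx
    have hrx' : HomPolytope.entries r.1.1 r.2.1 = x := by
      rw [h1, h2]
      ext (u | u) <;> rfl
    rwa [Set.mem_ofPred_eq, hrx']
  · intro p hp
    have hfin : Module.finrank ℝ ((Fin 2 → ℝ) →ᵃ[ℝ] (Fin 2 → ℝ)) = 6 := by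
      rw [AffineMap.finrank_eq, Module.finrank_fin_fun]
    rw [HomPolytope.homSet_eq_polyhedron]
    refine ⟨by rw [HomPolytope.affDim_polyhedron, hfin], fun f hf hrank => ?_⟩
    refine HomPolytope.isSimpleVertex_of_card_tight_le _ hf ?_
    rw [hfin, Nat.card_eq_fintype_card, Fintype.card_subtype]
    refine hH _ hp f (HomPolytope.bijective_of_affDim_image f _ hrank) _ fun u hu => ?_
    rw [← (Finset.mem_filter.1 hu).2]
    simp only [HomPolytope.pairing, Matrix.mulVec, dotProduct, Fin.sum_univ_two]
    rfl
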